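/- Let $p$ be a prime and let $f(x)=x+ax^{m+1}+\cdots$ and $g(x)=x+a'x^{m'+1}+\cdots$ be power series over $\mathbb{Q}_p$ with positive radius of convergence, where $m,m'\ge 1$, $a,a'\neq 0$, and the dots stand for terms of higher degree. A homeomorphism $h:U_1\to U_2$ between open neighborhoods of $0$ in $\mathbb{Q}_p$ with $h(0)=0$ is said to conjugate $f$ to $g$ if $U_1$ and $U_2$ lie in the open disks of convergence of $f$ and $g$ respectively, $f$ maps $U_1$ bijectively onto $U_1$, $g$ maps $U_2$ bijectively onto $U_2$, and $h\circ f=g\circ h$ on $U_1$. The $\mathbb{Z}_p$-orbit of a point $x$ of $U_1$ under $f$ (or of $U_2$ under $g$) is the closure in $\mathbb{Q}_p$ of its set of iterates $\{f^{\circ n}(x) : n\ge 0\}$ (respectively $\{g^{\circ n}(x) : n\ge 0\}$). Then there is a homeomorphism $h$ that conjugates $f$ to $g$. Suppose moreover that $m\le m'$. Then: 1. One may choose such an $h:U_1\to U_2$ and a constant $C>0$ so that - $|h(x)|\le C|x|^{m/m'}$ for all $x\in U_1$; - $|h(y)-h(x)|\le C|y-x|^{m/m'}$ whenever $x,y\in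 U_1$ are in the same $\mathbb{Z}_p$-orbit of $f$; - $|h^{-1}(y)-h^{-1}(x)|\le C|y-x|^{m/m'}$ whenever $x,y\in U_2$ are in the same $\mathbb{Z}_p$-orbit of $g$. 2. The exponent $m/m'$ in the first estimate cannot be improved: if $\alpha>m/m'$, then there are no homeomorphism $h$ between open neighborhoods of $0$ with $h(0)=0$ and $h\circ f=g\circ h$ near $0$, and no constant $C$, such that $|h(x)|\le C|x|^{\alpha}$ for all $x$ near $0$. -/

import Mathlib

open Filter Topology Set

noncomputable section

namespace PadicConj

variable {p : ℕ} [Fact p.Prime]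

/-- The radius of convergence `(limsup ‖aₙ‖^(1/n))⁻¹` at `0` of a power series `∑ aₙ xⁿ` over
`ℚ_p`, as an element of `[0, ∞]`. -/
def convRadius (F : PowerSeries ℚ_[p]) : ENNReal :=
  (FormalMultilinearSeries.ofScalars ℚ_[p] fun n => PowerSeries.coeff n F).radius

/-- A power series is analytic (at `0`) if its radius of convergence is positive. -/
def IsAnalytic (F : PowerSeries ℚ_[p]) : Prop := 0 < convRadius F

/-- The open disk of convergence of a power series. -/
def disk (F : PowerSeries ℚ_[p]) : Set ℚ_[p] := {x | ENNReal.ofReal ‖x‖ < convRadius F}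

/-- The function `x ↦ ∑ aₙ xⁿ` defined by a power series; it is only used inside the disk of
convergence. -/
def toFun (F : PowerSeries ℚ_[p]) (x : ℚ_[p]) : ℚ_[p] := ∑' n : ℕ, PowerSeries.coeff n F * x ^ n

/-- `F = x + a x^(m+1) + (terms of degree at least m + 2)`. -/
def HasLeadingForm (F : PowerSeries ℚ_[p]) (m : ℕ) (a : ℚ_[p]) : Prop :=
  ∃ R : PowerSeries ℚ_[p],
    F = PowerSeries.X + PowerSeries.C a * PowerSeries.X ^ (m + 1) + PowerSeries.X ^ (m + 2) * R

/-- The `ℤ_p`-orbit of `x` under `f`: the closure in `ℚ_p` of the set of iterates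
`x, f x, f (f x), …`. -/
def zpOrbit (f : ℚ_[p] → ℚ_[p]) (x : ℚ_[p]) : Set ℚ_[p] := closure (range fun n : ℕ => f^[n] x)

/-- The points `x` and `y` are in the same `ℤ_p`-orbit of `f`, for a map `f` of `U` to itself. -/
def SameZpOrbit (f : ℚ_[p] → ℚ_[p]) (U : Set ℚ_[p]) (x y : ℚ_[p]) : Prop :=
  ∃ w ∈ U, x ∈ zpOrbit f w ∧ y ∈ zpOrbit f w

/-- The homeomorphism `h : U₁ → U₂` (where `U₁ = h.source` and `U₂ = h.target`) between open
neighbourhoods of `0`, with `h 0 = 0`, conjugates `F` on `U₁` to `G` on `U₂`: both series converge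
there, `F` and `G` map `U₁` and `U₂` bijectively to themselves, and `h ∘ F = G ∘ h` on `U₁`. -/
structure Conjugates (h : OpenPartialHomeomorph ℚ_[p] ℚ_[p]) (F G : PowerSeries ℚ_[p]) :
    Prop where
  zero_mem : (0 : ℚ_[p]) ∈ h.source
  map_zero : h 0 = 0
  source_subset : h.source ⊆ disk F
  target_subset : h.target ⊆ disk G
  bijOn_source : BijOn (toFun F) h.source h.source
  bijOn_target : BijOn (toFun G) h.target h.target
  comm : ∀ x ∈ h.source, h (toFun F x) = toFun G (h x)

/-- The germ at `0` of the homeomorphism `h` conjugates the germ of `F` to the germ of `G`: here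
`h ∘ F = G ∘ h` is only required near `0`, and the neighbourhoods need not be invariant. -/
structure GermConjugates (h : OpenPartialHomeomorph ℚ_[p] ℚ_[p]) (F G : PowerSeries ℚ_[p]) :
    Prop where
  zero_mem : (0 : ℚ_[p]) ∈ h.source
  map_zero : h 0 = 0
  comm : ∀ᶠ x in 𝓝 (0 : ℚ_[p]), h (toFun F x) = toFun G (h x)

end PadicConj

end

namespace PadicConj

variable {p : ℕ} [Fact p.Prime]

/-! On a small sphere of radius `r`, `f` moves every point by exactly `‖a‖ r^(m+1) < r`, and the
displacement has a small Lipschitz constant, so `f` behaves like a translation. Hence `n ↦ f^n x`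
extends to a similarity from `ℤ_p` onto the closed ball of that radius about `x` (`exists_flow`).
The `ℤ_p`-orbits are therefore balls on which `f` is `s ↦ s + 1`, and the only invariants left are
their number and size.

The sphere of radius `r` contains about `r^(-m)` such balls. Listing the orbits by decreasing radius
gives `r n` comparable to `(n+1)^(-1/m)` (`exists_orbitChart`). Matching the `n`-th orbit of `f`
with the `n`-th orbit of `g` defines `h`. The radii then satisfy `r' n ≲ (r n)^(m/m')`, which gives
continuity at `0` and the first estimate; the orbitwise estimates compare `‖a‖ r^(m+1)` with `‖a'‖
r'^(m'+1)` (`exists_holder_on_orbits`).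

For optimality, any conjugacy permutes orbits near `0` (`exists_index_map`). By pigeonhole it cannot
send all late orbits of `f` to much later orbits of `g`, so some images are too large for an
exponent above `m/m'`. -/

/-! ### Local estimates for the displacement -/

lemma HasLeadingForm.coeff_eq {F : PowerSeries ℚ_[p]} {m : ℕ} {a : ℚ_[p]}
    (h : HasLeadingForm F m a) {n : ℕ} (hn : n < m + 2) :
    PowerSeries.coeff n F = (if n = 1 then 1 else 0) + if n = m + 1 then a else 0 := by
  obtain ⟨R, rfl⟩ := h
  have : ¬ m + 2 ≤ n := by omega
  simp [PowerSeries.coeff_X, PowerSeries.coeff_X_pow, PowerSeries.coeff_X_pow_mul', this]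

lemma hasFPowerSeriesAt_toFun {F : PowerSeries ℚ_[p]} (hF : IsAnalytic F) :
    HasFPowerSeriesAt (toFun F)
      (FormalMultilinearSeries.ofScalars ℚ_[p] fun n => PowerSeries.coeff n F) 0 := by
  have h := (FormalMultilinearSeries.hasFPowerSeriesOnBall _ hF).hasFPowerSeriesAt
  convert h using 1
  funext x
  exact (FormalMultilinearSeries.ofScalars_sum_eq (fun n => PowerSeries.coeff n F) x).symm

lemma toFun_zero {F : PowerSeries ℚ_[p]} {m : ℕ} {a : ℚ_[p]}
    (h : HasLeadingForm F m a) (hm : 1 ≤ m) : toFun F 0 = 0 := by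
  have h0 : PowerSeries.coeff 0 F = 0 := by
    rw [h.coeff_eq (by omega)]; simp
  rw [toFun, tsum_eq_single 0 (fun n hn => by simp [hn])]
  rw [h0, zero_mul]

lemma disk_mem_nhds {F : PowerSeries ℚ_[p]} (hF : IsAnalytic F) : disk F ∈ 𝓝 0 := by
  have hc : Continuous fun x : ℚ_[p] => ENNReal.ofReal ‖x‖ :=
    ENNReal.continuous_ofReal.comp continuous_norm
  refine hc.continuousAt.eventually_lt continuousAt_const ?_
  simpa [IsAnalytic] using hF

lemma partialSum_leading {F : PowerSeries ℚ_[p]} {m : ℕ} {a : ℚ_[p]}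
    (h : HasLeadingForm F m a) (x : ℚ_[p]) :
    (FormalMultilinearSeries.ofScalars ℚ_[p] fun n => PowerSeries.coeff n F).partialSum (m + 2) x
      = x + a * x ^ (m + 1) := by
  have : ∀ n ∈ Finset.range (m + 2),
      (FormalMultilinearSeries.ofScalars ℚ_[p] (fun n => PowerSeries.coeff n F) n) (fun _ => x)
        = (if n = 1 then x ^ n else 0) + if n = m + 1 then a * x ^ n else 0 := by
    intro n hn
    rw [FormalMultilinearSeries.ofScalars_apply_eq, h.coeff_eq (Finset.mem_range.1 hn), smul_eq_mul,
      add_mul]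
    simp
  rw [FormalMultilinearSeries.partialSum, Finset.sum_congr rfl this, Finset.sum_add_distrib]
  simp

/-- The remainder is `O(‖x‖^(m+2))`, so near `0` the leading term strictly dominates it; in an
ultrametric this forces equality of norms. -/
lemma eventually_norm_toFun_sub {F : PowerSeries ℚ_[p]} {m : ℕ} {a : ℚ_[p]} (hF : IsAnalytic F)
    (h : HasLeadingForm F m a) (ha : a ≠ 0) :
    ∀ᶠ x in 𝓝 (0 : ℚ_[p]), ‖toFun F x - x‖ = ‖a‖ * ‖x‖ ^ (m + 1) := by
  obtain ⟨C, hC⟩ := ((hasFPowerSeriesAt_toFun hF).isBigO_sub_partialSum_pow (m + 2)).bound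
  have hsmall : ∀ᶠ x in 𝓝 (0 : ℚ_[p]), C * ‖x‖ < ‖a‖ := by
    refine ContinuousAt.eventually_lt (by fun_prop) continuousAt_const ?_
    simpa using ha
  filter_upwards [hC, hsmall] with x hx hs
  rcases eq_or_ne x 0 with rfl | hx0
  · simp only [zero_add, partialSum_leading h, norm_zero] at hx
    simpa using hx
  rw [zero_add, partialSum_leading h] at hx
  have hpos : 0 < ‖x‖ := norm_pos_iff.2 hx0
  have hlt : ‖toFun F x - (x + a * x ^ (m + 1))‖ < ‖a * x ^ (m + 1)‖ := by
    refine hx.trans_lt ?_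
    rw [norm_mul, norm_pow, norm_pow, norm_norm]
    calc C * ‖x‖ ^ (m + 2) = C * ‖x‖ * ‖x‖ ^ (m + 1) := by ring
      _ < _ := by gcongr
  have := IsUltrametricDist.norm_add_eq_max_of_norm_ne_norm hlt.ne
  rw [max_eq_right hlt.le] at this
  rw [← norm_pow, ← norm_mul, ← this]
  congr 1; ring

/-- The linear coefficient is `1`, so the displacement has strict derivative `0` at the origin. -/
lemma eventually_toFun_sub_lipschitz {F : PowerSeries ℚ_[p]} {m : ℕ} {a : ℚ_[p]}
    (hF : IsAnalytic F) (h : HasLeadingForm F m a) (hm : 1 ≤ m) {c : ℝ} (hc : 0 < c) :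
    ∃ s ∈ 𝓝 (0 : ℚ_[p]), ∀ x ∈ s, ∀ y ∈ s,
      ‖(toFun F x - x) - (toFun F y - y)‖ ≤ c * ‖x - y‖ := by
  have hd := (hasFPowerSeriesAt_toFun hF).hasStrictDerivAt
  obtain ⟨s, hs, hl⟩ := HasStrictFDerivAt.approximates_deriv_on_nhds hd
    (c := ⟨c, hc.le⟩) (Or.inr hc)
  refine ⟨s, hs, fun x hx y hy => ?_⟩
  have hxy := hl x hx y hy
  have h1 : PowerSeries.coeff 1 F = 1 := by
    rw [h.coeff_eq (by omega), if_pos rfl, if_neg (by omega), add_zero]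
  simp only [FormalMultilinearSeries.ofScalars_apply_eq, h1, one_pow, smul_eq_mul, mul_one,
    ContinuousLinearMap.toSpanSingleton_apply] at hxy
  rwa [sub_sub_sub_comm]

/-! ### Near-translations and their `ℤ_p`-flows -/

/-- `T` maps `S` to itself, moves every point of `S` by exactly `c`, and its displacement
`x ↦ T x - x` is `p⁻²`-Lipschitz on `S`. -/
structure IsNearTranslation (T : ℚ_[p] → ℚ_[p]) (S : Set ℚ_[p]) (c : ℝ) : Prop where
  mapsTo : MapsTo T S S
  norm_sub : ∀ x ∈ S, ‖T x - x‖ = c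
  lipschitz : ∀ x ∈ S, ∀ y ∈ S, ‖(T x - x) - (T y - y)‖ ≤ (p : ℝ)⁻¹ ^ 2 * ‖x - y‖

lemma inv_prime_pos : (0 : ℝ) < (p : ℝ)⁻¹ :=
  inv_pos.2 (by exact_mod_cast (Fact.out : p.Prime).pos)

lemma inv_prime_lt_one : (p : ℝ)⁻¹ < 1 :=
  inv_lt_one_of_one_lt₀ (by exact_mod_cast (Fact.out : p.Prime).one_lt)

lemma inv_prime_le_norm_prime {q : ℕ} (hq : q.Prime) : (p : ℝ)⁻¹ ≤ ‖(q : ℚ_[p])‖ := by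
  rcases eq_or_ne q p with rfl | hqp
  · simp
  · have : ¬ ‖(q : ℚ_[p])‖ < 1 := by
      rw [Padic.norm_natCast_lt_one_iff]
      intro hd
      exact hqp ((Nat.prime_dvd_prime_iff_eq Fact.out hq).1 hd).symm
    exact inv_prime_lt_one.le.trans (not_lt.1 this)

lemma norm_natCast_le_one (n : ℕ) : ‖(n : ℚ_[p])‖ ≤ 1 := by
  exact_mod_cast Padic.norm_int_le_one (p := p) (n : ℤ)

lemma norm_add_le_of_le {x y : ℚ_[p]} {C : ℝ} (hx : ‖x‖ ≤ C) (hy : ‖y‖ ≤ C) : ‖x + y‖ ≤ C :=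
  (IsUltrametricDist.norm_add_le_max x y).trans (max_le hx hy)

namespace IsNearTranslation

variable {T : ℚ_[p] → ℚ_[p]} {S : Set ℚ_[p]} {c : ℝ}

lemma iterate_mem (h : IsNearTranslation T S c) {x : ℚ_[p]} (hx : x ∈ S) (n : ℕ) :
    T^[n] x ∈ S := h.mapsTo.iterate n hx

lemma nonneg (h : IsNearTranslation T S c) {x : ℚ_[p]} (hx : x ∈ S) : 0 ≤ c :=
  h.norm_sub x hx ▸ norm_nonneg _

lemma norm_map_sub (h : IsNearTranslation T S c) {x y : ℚ_[p]} (hx : x ∈ S) (hy : y ∈ S) :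
    ‖T x - T y‖ = ‖x - y‖ := by
  rcases eq_or_ne x y with rfl | hxy
  · simp
  have hpos : 0 < ‖x - y‖ := norm_pos_iff.2 (sub_ne_zero.2 hxy)
  have hlt : ‖(T x - x) - (T y - y)‖ < ‖x - y‖ := by
    refine (h.lipschitz x hx y hy).trans_lt ?_
    have := pow_lt_one₀ inv_prime_pos.le (inv_prime_lt_one (p := p)) two_ne_zero
    nlinarith
  have := IsUltrametricDist.norm_add_eq_max_of_norm_ne_norm hlt.ne
  rw [max_eq_right hlt.le] at this
  rw [← this]; congr 1; ring

lemma norm_iterate_sub_iterate (h : IsNearTranslation T S c) {x y : ℚ_[p]} (hx : x ∈ S)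
    (hy : y ∈ S) (n : ℕ) : ‖T^[n] x - T^[n] y‖ = ‖x - y‖ := by
  induction n with
  | zero => rfl
  | succ n ih =>
    rw [Function.iterate_succ_apply', Function.iterate_succ_apply',
      h.norm_map_sub (h.iterate_mem hx n) (h.iterate_mem hy n), ih]

lemma iterate_lipschitz (h : IsNearTranslation T S c) {x y : ℚ_[p]} (hx : x ∈ S)
    (hy : y ∈ S) (n : ℕ) :
    ‖(T^[n] x - x) - (T^[n] y - y)‖ ≤ (p : ℝ)⁻¹ ^ 2 * ‖x - y‖ := by
  induction n with
  | zero => simp; positivity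
  | succ n ih =>
    have h1 := h.lipschitz _ (h.iterate_mem hx n) _ (h.iterate_mem hy n)
    rw [h.norm_iterate_sub_iterate hx hy] at h1
    rw [Function.iterate_succ_apply', Function.iterate_succ_apply']
    convert norm_add_le_of_le h1 ih using 2
    ring

/-- To first order, the `n`-th iterate translates by `n` times the displacement. -/
lemma norm_iterate_sub_sub_le (h : IsNearTranslation T S c) (n : ℕ) {x : ℚ_[p]} (hx : x ∈ S) :
    ‖T^[n] x - x - n * (T x - x)‖ ≤ (p : ℝ)⁻¹ * (‖(n : ℚ_[p])‖ * c) := by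
  have hp := inv_prime_pos (p := p)
  have hp1 := inv_prime_lt_one (p := p)
  have hc := h.nonneg hx
  induction n using induction_on_primes generalizing x with
  | zero => simp
  | one => simp; positivity
  | prime_mul r q hr ih =>
    have hq : ∀ y ∈ S, ‖T^[q] y - y‖ ≤ ‖(q : ℚ_[p])‖ * c := by
      intro y hy
      have h1 : ‖(q : ℚ_[p]) * (T y - y)‖ ≤ ‖(q : ℚ_[p])‖ * c := by
        rw [norm_mul, h.norm_sub y hy]
      have h2 := (ih hy).trans (mul_le_of_le_one_left (by positivity) hp1.le)
      convert norm_add_le_of_le h2 h1 using 2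
      ring
    have hmem : ∀ i, T^[q * i] x ∈ S := fun i => h.iterate_mem hx _
    have hstep : ∀ i, T^[q * (i + 1)] x = T^[q] (T^[q * i] x) := by
      intro i
      rw [← Function.iterate_add_apply]; congr 1; ring
    have hdist : ∀ i, ‖T^[q * i] x - x‖ ≤ ‖(q : ℚ_[p])‖ * c := by
      intro i
      induction i with
      | zero => simp; positivity
      | succ i ihi =>
        rw [hstep]
        convert norm_add_le_of_le (hq _ (hmem i)) ihi using 2
        ring
    -- Telescoping over blocks of `q` steps: by the ultrametric inequality the error does not grow
    -- with `i`.
    have hsum : ∀ i : ℕ, ‖T^[q * i] x - x - i * (T^[q] x - x)‖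
        ≤ (p : ℝ)⁻¹ ^ 2 * (‖(q : ℚ_[p])‖ * c) := by
      intro i
      induction i with
      | zero => simp; positivity
      | succ i ihi =>
        rw [hstep]
        have h1 := (h.iterate_lipschitz (hmem i) hx q).trans
          (mul_le_mul_of_nonneg_left (hdist i) (by positivity))
        convert norm_add_le_of_le h1 ihi using 2
        push_cast; ring
    have h1 : ‖T^[q * r] x - x - r * (T^[q] x - x)‖
        ≤ (p : ℝ)⁻¹ * (‖((r * q : ℕ) : ℚ_[p])‖ * c) := by
      refine (hsum r).trans ?_
      push_cast
      rw [norm_mul, pow_two, mul_assoc, mul_assoc]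
      -- This is why the Lipschitz constant is `p⁻²`: one factor `p⁻¹` is absorbed by `‖r‖ ≥ p⁻¹`,
      -- the other remains in the bound.
      have := inv_prime_le_norm_prime (p := p) hr
      gcongr
    have h2 : ‖(r : ℚ_[p]) * (T^[q] x - x - q * (T x - x))‖
        ≤ (p : ℝ)⁻¹ * (‖((r * q : ℕ) : ℚ_[p])‖ * c) := by
      push_cast
      rw [norm_mul, norm_mul]
      calc _ ≤ ‖(r : ℚ_[p])‖ * ((p : ℝ)⁻¹ * (‖(q : ℚ_[p])‖ * c)) := by gcongr; exact ih hx
        _ = _ := by ring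
    rw [mul_comm r q] at h1 h2 ⊢
    convert norm_add_le_of_le h1 h2 using 2
    push_cast; ring

lemma norm_iterate_sub_self (h : IsNearTranslation T S c) (n : ℕ) {x : ℚ_[p]} (hx : x ∈ S) :
    ‖T^[n] x - x‖ = ‖(n : ℚ_[p])‖ * c := by
  have h1 := h.norm_iterate_sub_sub_le n hx
  have h2 : ‖(n : ℚ_[p]) * (T x - x)‖ = ‖(n : ℚ_[p])‖ * c := by rw [norm_mul, h.norm_sub x hx]
  have hc := h.nonneg hx
  rcases (mul_nonneg (norm_nonneg (n : ℚ_[p])) hc).eq_or_lt with h0 | h0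
  · rw [← h0] at h1 h2 ⊢
    rw [mul_zero] at h1
    have := norm_add_le_of_le h1 h2.le
    rw [sub_add_cancel] at this
    exact le_antisymm this (norm_nonneg _)
  · have hlt : ‖T^[n] x - x - n * (T x - x)‖ < ‖(n : ℚ_[p]) * (T x - x)‖ := by
      rw [h2]
      exact h1.trans_lt (mul_lt_of_lt_one_left h0 inv_prime_lt_one)
    have := IsUltrametricDist.norm_add_eq_max_of_norm_ne_norm hlt.ne
    rw [max_eq_right hlt.le, sub_add_cancel] at this
    rw [this, h2]

lemma norm_iterate_sub (h : IsNearTranslation T S c) (n k : ℕ) {x : ℚ_[p]} (hx : x ∈ S) :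
    ‖T^[n] x - T^[k] x‖ = ‖(n : ℤ_[p]) - k‖ * c := by
  wlog hnk : k ≤ n generalizing n k
  · rw [norm_sub_rev, this k n (le_of_not_ge hnk), norm_sub_rev]
  obtain ⟨d, rfl⟩ := Nat.exists_eq_add_of_le' hnk
  rw [Function.iterate_add_apply, h.norm_iterate_sub_self d (h.iterate_mem hx k)]
  simp [← PadicInt.padic_norm_e_of_padicInt]

/-- The orbit of `x` comes arbitrarily close to each point at distance at most `c` from `x`. -/
lemma exists_iterate_near (h : IsNearTranslation T S c) (hc : 0 < c) {x z : ℚ_[p]} (hx : x ∈ S)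
    (hz : ‖z - x‖ ≤ c) (k : ℕ) : ∃ n : ℕ, ‖z - T^[n] x‖ ≤ (p : ℝ)⁻¹ ^ k * c := by
  induction k with
  | zero => exact ⟨0, by simpa using hz⟩
  | succ k ih =>
    obtain ⟨n, hn⟩ := ih
    have hy := h.iterate_mem hx n
    set y := T^[n] x
    have hu := h.norm_sub y hy
    have hu0 : T y - y ≠ 0 := norm_pos_iff.1 (hu ▸ hc)
    -- Newton-type correction: `t` is the number of steps of length `T y - y` from `y` to `z`. A
    -- natural number `d` congruent to it modulo `p^(k+1)` gains one digit.
    set t := (z - y) / (T y - y) with ht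
    have htn : ‖t‖ ≤ (p : ℝ)⁻¹ ^ k := by
      rw [ht, norm_div, hu, div_le_iff₀ hc]; exact hn
    have ht1 : ‖t‖ ≤ 1 := htn.trans (pow_le_one₀ inv_prime_pos.le inv_prime_lt_one.le)
    obtain ⟨τ, hτ⟩ : ∃ τ : ℤ_[p], (τ : ℚ_[p]) = t := ⟨⟨t, ht1⟩, rfl⟩
    have happr := (PadicInt.norm_le_pow_iff_mem_span_pow _ _).2
      (PadicInt.appr_spec (k + 1) τ)
    set d := τ.appr (k + 1)
    have h1 : ‖t - d‖ ≤ (p : ℝ)⁻¹ ^ (k + 1) := by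
      have h2 : ‖τ - d‖ = ‖t - d‖ := by
        rw [← PadicInt.padic_norm_e_of_padicInt, ← hτ]; simp
      rw [← h2]
      refine happr.trans_eq ?_
      rw [zpow_neg, zpow_natCast, inv_pow]
    have hd : ‖(d : ℚ_[p])‖ ≤ (p : ℝ)⁻¹ ^ k := by
      have h3 : ‖t - d‖ ≤ (p : ℝ)⁻¹ ^ k :=
        h1.trans (pow_le_pow_of_le_one inv_prime_pos.le inv_prime_lt_one.le (Nat.le_succ k))
      have := norm_add_le_of_le htn ((norm_neg (t - d)).trans_le h3)
      simpa using this
    refine ⟨d + n, ?_⟩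
    rw [Function.iterate_add_apply]
    have e1 : ‖(t - d) * (T y - y)‖ ≤ (p : ℝ)⁻¹ ^ (k + 1) * c := by
      rw [norm_mul, hu]; gcongr
    have e2 : ‖-(T^[d] y - y - d * (T y - y))‖ ≤ (p : ℝ)⁻¹ ^ (k + 1) * c := by
      rw [norm_neg]
      refine (h.norm_iterate_sub_sub_le d hy).trans ?_
      rw [pow_succ', mul_assoc]
      have := inv_prime_pos (p := p)
      gcongr
    convert norm_add_le_of_le e1 e2 using 2
    have : t * (T y - y) = z - y := div_mul_cancel₀ _ hu0
    linear_combination -this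

/-- Iteration extends from natural to `p`-adic integer exponents. -/
lemma exists_flow (h : IsNearTranslation T S c) (hc : 0 < c) {x : ℚ_[p]} (hx : x ∈ S)
    (hS : Metric.closedBall x c ⊆ S) :
    ∃ φ : ℤ_[p] → ℚ_[p], φ 0 = x ∧ (∀ s t, ‖φ s - φ t‖ = c * ‖s - t‖) ∧
      (∀ s, T (φ s) = φ (s + 1)) ∧ range φ = Metric.closedBall x c := by
  have hlip : ∀ n k : ℕ, ‖T^[n] x - T^[k] x‖ = ‖(n : ℤ_[p]) - k‖ * c :=
    fun n k => h.norm_iterate_sub n k hx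
  have happr : ∀ s : ℤ_[p], Tendsto (fun k => ((s.appr k : ℕ) : ℤ_[p])) atTop (𝓝 s) := by
    intro s
    rw [tendsto_iff_norm_sub_tendsto_zero]
    refine squeeze_zero (fun _ => norm_nonneg _) (fun k => ?_)
      (tendsto_pow_atTop_nhds_zero_of_lt_one (inv_prime_pos (p := p)).le inv_prime_lt_one)
    rw [norm_sub_rev, inv_pow, ← zpow_natCast, ← zpow_neg]
    exact (PadicInt.norm_le_pow_iff_mem_span_pow _ _).2 (PadicInt.appr_spec k s)
  have hconv : ∀ s : ℤ_[p], ∃ y, Tendsto (fun k => T^[s.appr k] x) atTop (𝓝 y) := by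
    intro s
    refine cauchySeq_tendsto_of_complete ?_
    have hcs := (happr s).cauchySeq
    rw [Metric.cauchySeq_iff] at hcs ⊢
    intro ε hε
    obtain ⟨N, hN⟩ := hcs (ε / c) (div_pos hε hc)
    refine ⟨N, fun i hi j hj => ?_⟩
    have := hN i hi j hj
    rw [dist_eq_norm, lt_div_iff₀ hc] at this
    rwa [dist_eq_norm, hlip]
  choose φ hφ using hconv
  have hiso : ∀ s t, ‖φ s - φ t‖ = c * ‖s - t‖ := by
    intro s t
    have h1 := ((hφ s).sub (hφ t)).norm
    have h2 := (((happr s).sub (happr t)).norm).mul_const c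
    rw [mul_comm]
    refine tendsto_nhds_unique h1 (h2.congr fun k => ?_)
    rw [hlip]
  have hnat : ∀ n : ℕ, φ n = T^[n] x := by
    intro n
    refine tendsto_nhds_unique (hφ n) ?_
    rw [tendsto_iff_norm_sub_tendsto_zero]
    simp only [hlip]
    have := (tendsto_iff_norm_sub_tendsto_zero.1 (happr (n : ℤ_[p]))).mul_const c
    simpa using this
  have hφ0 : φ 0 = x := by simpa using hnat 0
  have hcont : Continuous φ := by
    refine (LipschitzWith.of_dist_le_mul (K := ⟨c, hc.le⟩) fun s t => ?_).continuous
    rw [dist_eq_norm, dist_eq_norm, hiso]; rfl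
  have hball : ∀ s, φ s ∈ Metric.closedBall x c := by
    intro s
    rw [mem_closedBall_iff_norm]
    nth_rewrite 1 [← hφ0]
    rw [hiso]
    exact mul_le_of_le_one_right hc.le (PadicInt.norm_le_one _)
  have hmem : ∀ s, φ s ∈ S := fun s => hS (hball s)
  have hTcont : Continuous fun s => T (φ s) := by
    refine (LipschitzWith.of_dist_le_mul (K := ⟨c, hc.le⟩) fun s t => ?_).continuous
    rw [dist_eq_norm, dist_eq_norm, h.norm_map_sub (hmem s) (hmem t), hiso]; rfl
  refine ⟨φ, hφ0, hiso, fun s => ?_, ?_⟩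
  · refine congr_fun (PadicInt.denseRange_natCast.equalizer hTcont
      (hcont.comp (continuous_add_const 1)) (funext fun n => ?_)) s
    have := hnat (n + 1)
    push_cast at this
    simp only [Function.comp_apply, hnat, this, Function.iterate_succ_apply']
  · refine Subset.antisymm (range_subset_iff.2 hball) fun z hz => ?_
    -- By compactness of `ℤ_p`, it is enough that the natural iterates are dense in the ball.
    have hclosed : IsClosed (range φ) := (isCompact_range hcont).isClosed
    rw [← hclosed.closure_eq, Metric.mem_closure_iff]
    intro ε hε
    have hlim : Tendsto (fun k : ℕ => (p : ℝ)⁻¹ ^ k * c) atTop (𝓝 (0 * c)) :=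
      (tendsto_pow_atTop_nhds_zero_of_lt_one (inv_prime_pos (p := p)).le
        inv_prime_lt_one).mul_const c
    rw [zero_mul] at hlim
    obtain ⟨k, hk⟩ := (hlim.eventually_lt_const hε).exists
    obtain ⟨n, hn⟩ := h.exists_iterate_near hc hx (mem_closedBall_iff_norm.1 hz) k
    exact ⟨_, ⟨n, rfl⟩, by rw [dist_eq_norm, hnat]; exact hn.trans_lt hk⟩

end IsNearTranslation

/-! ### Enumerating blocks, and counting balls in a sphere -/

lemma exists_sigma_fin_equiv_nat (N : ℕ → ℕ) (hN : ∀ j, 0 < N j) :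
    ∃ e : (Σ j, Fin (N j)) ≃ ℕ, ∀ j i,
      ∑ l ∈ Finset.range j, N l ≤ e ⟨j, i⟩ ∧ e ⟨j, i⟩ < ∑ l ∈ Finset.range (j + 1), N l := by
  set A : ℕ → ℕ := fun j => ∑ l ∈ Finset.range j, N l with hA
  have hsucc : ∀ j, A (j + 1) = A j + N j := fun j => Finset.sum_range_succ N j
  have hmono : StrictMono A := strictMono_nat_of_lt_succ fun j => by
    rw [hsucc]; exact Nat.lt_add_of_pos_right (hN j)
  let ι : (Σ j, Fin (N j)) → ℕ := fun x => A x.1 + x.2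
  have hι : ∀ j (i : Fin (N j)), A j ≤ ι ⟨j, i⟩ ∧ ι ⟨j, i⟩ < A (j + 1) := fun j i =>
    ⟨Nat.le_add_right _ _, by rw [hsucc]; exact Nat.add_lt_add_left i.2 _⟩
  have hbij : Function.Bijective ι := by
    constructor
    · rintro ⟨j, i⟩ ⟨j', i'⟩ h
      have h1 := hι j i
      have h2 := hι j' i'
      rw [h] at h1
      obtain rfl : j = j' := by
        have a1 := hmono.lt_iff_lt.1 (h1.1.trans_lt h2.2)
        have a2 := hmono.lt_iff_lt.1 (h2.1.trans_lt h1.2)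
        omega
      have : (i : ℕ) = i' := Nat.add_left_cancel h
      rw [Fin.ext this]
    · intro n
      have hex : ∃ j, n < A (j + 1) :=
        ⟨n, (Nat.lt_succ_self n).trans_le (hmono.le_apply)⟩
      have hlt := Nat.find_spec hex
      have hle : A (Nat.find hex) ≤ n := by
        rcases hj : Nat.find hex with _ | j
        · simp [hA]
        · exact not_lt.1 (Nat.find_min hex (m := j) (by omega))
      rw [hsucc] at hlt
      exact ⟨⟨Nat.find hex, ⟨n - A (Nat.find hex), by omega⟩⟩, Nat.add_sub_cancel' hle⟩
  exact ⟨Equiv.ofBijective ι hbij, hι⟩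

/-- Blocks of geometrically growing size can be listed one after the other, so that the position
of an element of the `j`-th block is comparable to `P ^ j`. -/
lemma exists_sigma_equiv_nat {ι : ℕ → Type*} [∀ j, Fintype (ι j)] {N P : ℕ} (hN : 0 < N)
    (hP : 2 ≤ P) (hcard : ∀ j, Fintype.card (ι j) = N * P ^ j) :
    ∃ e : (Σ j, ι j) ≃ ℕ, ∀ x : Σ j, ι j,
      P ^ x.1 ≤ P * (e x + 1) ∧ e x + 1 ≤ 2 * N * P ^ x.1 := by
  obtain ⟨e, he⟩ := exists_sigma_fin_equiv_nat (fun j => N * P ^ j) (fun j => by positivity)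
  refine ⟨(Equiv.sigmaCongrRight fun j => Fintype.equivFinOfCardEq (hcard j)).trans e, ?_⟩
  rintro ⟨j, i⟩
  obtain ⟨h1, h2⟩ := he j (Fintype.equivFinOfCardEq (hcard j) i)
  simp only [Equiv.trans_apply, Equiv.sigmaCongrRight_apply]
  set n := e ⟨j, Fintype.equivFinOfCardEq (hcard j) i⟩
  constructor
  · rcases j with _ | j
    · simp; nlinarith [Nat.zero_le (P * n)]
    · rw [pow_succ']
      refine Nat.mul_le_mul_left _ (Nat.le_succ_of_le (le_trans ?_ h1))
      rw [Finset.sum_range_succ]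
      -- Block `j` alone, which precedes block `j + 1`, already has at least `P ^ j` elements.
      exact (Nat.le_mul_of_pos_left _ hN).trans (Nat.le_add_left _ _)
  · refine (Nat.succ_le_of_lt h2).trans ?_
    clear h1 h2
    induction j with
    | zero => simp; omega
    | succ j ih =>
      rw [Finset.sum_range_succ]
      -- The induction hypothesis asks for an element of block `j`, on which the bound does not
      -- depend; any one serves.
      have := ih (Fintype.equivFinOfCardEq (hcard j) |>.symm ⟨0, by positivity⟩)
      have h3 : N * P ^ j * 2 ≤ N * P ^ j * P := Nat.mul_le_mul_left _ hP
      calc _ ≤ 2 * N * P ^ j + N * P ^ (j + 1) := by gcongr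
        _ ≤ _ := by rw [pow_succ]; nlinarith

/-- Representatives of the balls of radius `p ^ -(k + E)` in the sphere of radius `p ^ -k`. -/
lemma exists_sphere_representatives (k : ℕ) {E : ℕ} (hE : E ≠ 0) :
    ∃ z : (ZMod (p ^ E))ˣ → ℚ_[p], (∀ r, ‖z r‖ = (p : ℝ)⁻¹ ^ k) ∧ ∀ x : ℚ_[p], ‖x‖ = (p : ℝ)⁻¹ ^ k →
      ∃! r, ‖x - z r‖ ≤ (p : ℝ)⁻¹ ^ (k + E) := by
  have hp0 : (p : ℚ_[p]) ≠ 0 := by exact_mod_cast (Fact.out : p.Prime).ne_zero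
  have : NeZero (p ^ E) := ⟨pow_ne_zero _ (Fact.out : p.Prime).ne_zero⟩
  refine ⟨fun r => p ^ k * (((r : ZMod (p ^ E)).val : ℕ) : ℚ_[p]), fun r => ?_, fun x hx => ?_⟩
  · have hcop : ((r : ZMod (p ^ E)).val).Coprime p :=
      (ZMod.val_coe_unit_coprime r).coprime_dvd_right (dvd_pow_self p hE)
    have h1 : ‖(((r : ZMod (p ^ E)).val : ℕ) : ℚ_[p])‖ = 1 := by
      refine le_antisymm (norm_natCast_le_one _) (not_lt.1 fun hlt => ?_)
      rw [Padic.norm_natCast_lt_one_iff, (Fact.out : p.Prime).dvd_iff_not_coprime] at hlt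
      exact hlt hcop.symm
    rw [norm_mul, norm_pow, Padic.norm_p, h1, mul_one]
  have hq := inv_prime_pos (p := p)
  have hy1 : ‖x / p ^ k‖ = 1 := by
    rw [norm_div, norm_pow, Padic.norm_p, hx, div_self (by positivity)]
  obtain ⟨y, hy⟩ : ∃ y : ℤ_[p], (y : ℚ_[p]) = x / p ^ k := ⟨⟨_, hy1.le⟩, rfl⟩
  have hxy : x = p ^ k * y := by rw [hy, mul_div_cancel₀ _ (pow_ne_zero _ hp0)]
  have hyu : IsUnit y := by
    rw [PadicInt.isUnit_iff, ← PadicInt.padic_norm_e_of_padicInt, hy, hy1]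
  -- After division by `p ^ k`, lying in the ball of `z r` is a congruence modulo `p ^ E`.
  have key : ∀ r : (ZMod (p ^ E))ˣ,
      ‖x - p ^ k * (((r : ZMod (p ^ E)).val : ℕ) : ℚ_[p])‖ ≤ (p : ℝ)⁻¹ ^ (k + E) ↔
        PadicInt.toZModPow E y = r := by
    intro r
    rw [hxy, ← mul_sub, norm_mul, norm_pow, Padic.norm_p, pow_add,
      mul_le_mul_iff_right₀ (by positivity)]
    have h1 : ‖(y : ℚ_[p]) - (((r : ZMod (p ^ E)).val : ℕ) : ℚ_[p])‖
        = ‖y - (((r : ZMod (p ^ E)).val : ℕ) : ℤ_[p])‖ := by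
      rw [← PadicInt.padic_norm_e_of_padicInt, PadicInt.coe_sub, PadicInt.coe_natCast]
    have h2 : (p : ℝ)⁻¹ ^ E = (p : ℝ) ^ (-(E : ℤ)) := by
      rw [zpow_neg, zpow_natCast, inv_pow]
    rw [h1, h2, PadicInt.norm_le_pow_iff_mem_span_pow, ← PadicInt.ker_toZModPow, RingHom.mem_ker,
      map_sub, map_natCast, ZMod.natCast_zmod_val, sub_eq_zero]
  refine ⟨(hyu.map (PadicInt.toZModPow E)).unit, (key _).2 rfl, fun r hr => ?_⟩
  exact Units.ext ((key r).1 hr).symm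

/-! ### Orbit charts and their existence -/

lemma norm_eq_of_norm_sub_lt {x y : ℚ_[p]} (h : ‖y - x‖ < ‖x‖) : ‖y‖ = ‖x‖ := by
  have := IsUltrametricDist.norm_add_eq_max_of_norm_ne_norm h.ne
  rwa [sub_add_cancel, max_eq_right h.le] at this

/-- A neighbourhood of `0` invariant under `F`, with a parametrization of its `ℤ_p`-orbits other
than `{0}`: the `n`-th orbit `Φ n` lies on the sphere of radius `r n`, on which `F` acts by
`s ↦ s + 1`. -/
structure OrbitChart (F : PowerSeries ℚ_[p]) (m : ℕ) (a : ℚ_[p]) where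
  U : Set ℚ_[p]
  Φ : ℕ → ℤ_[p] → ℚ_[p]
  r : ℕ → ℝ
  isOpen_U : IsOpen U
  U_subset : U ⊆ disk F
  map_zero : toFun F 0 = 0
  map_Φ : ∀ n s, toFun F (Φ n s) = Φ n (s + 1)
  r_pos : ∀ n, 0 < r n
  r_le_one : ∀ n, r n ≤ 1
  norm_Φ : ∀ n s, ‖Φ n s‖ = r n
  norm_Φ_sub : ∀ n s t, ‖Φ n s - Φ n t‖ = ‖a‖ * r n ^ (m + 1) * ‖s - t‖
  index_eq : ∀ n k s t, Φ n s = Φ k t → n = k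
  mem_U_iff : ∀ x, x ∈ U ↔ x = 0 ∨ ∃ n s, Φ n s = x
  isOpen_range : ∀ n, IsOpen (range (Φ n))
  lower : ℝ
  lower_pos : 0 < lower
  lower_le : ∀ n, lower ≤ (n + 1) * r n ^ m
  upper : ℝ
  le_upper : ∀ n, (n + 1) * r n ^ m ≤ upper

/-- The condition `‖a‖ * ‖x‖ ^ m < 1` makes the displacement shorter than `‖x‖`, so that spheres are
invariant. -/
lemma exists_good_ball {F : PowerSeries ℚ_[p]} {m : ℕ} {a : ℚ_[p]} (hF : IsAnalytic F)
    (h : HasLeadingForm F m a) (hm : 1 ≤ m) (ha : a ≠ 0) {W : Set ℚ_[p]} (hW : W ∈ 𝓝 0) :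
    ∃ k : ℕ, ∀ x : ℚ_[p], ‖x‖ ≤ (p : ℝ)⁻¹ ^ k → x ∈ W ∧ x ∈ disk F ∧
      ‖toFun F x - x‖ = ‖a‖ * ‖x‖ ^ (m + 1) ∧ ‖a‖ * ‖x‖ ^ m < 1 ∧
      ∀ y : ℚ_[p], ‖y‖ ≤ (p : ℝ)⁻¹ ^ k →
        ‖(toFun F x - x) - (toFun F y - y)‖ ≤ (p : ℝ)⁻¹ ^ 2 * ‖x - y‖ := by
  have hq := inv_prime_pos (p := p)
  obtain ⟨s, hs, hl⟩ := eventually_toFun_sub_lipschitz hF h hm (pow_pos hq 2)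
  have h1 : ∀ᶠ x in 𝓝 (0 : ℚ_[p]), ‖a‖ * ‖x‖ ^ m < 1 := by
    refine ContinuousAt.eventually_lt (by fun_prop) continuousAt_const ?_
    simp [Nat.one_le_iff_ne_zero.1 hm]
  have hall : ∀ᶠ x in 𝓝 (0 : ℚ_[p]), x ∈ W ∧ x ∈ disk F ∧
      ‖toFun F x - x‖ = ‖a‖ * ‖x‖ ^ (m + 1) ∧ ‖a‖ * ‖x‖ ^ m < 1 ∧ x ∈ s := by
    filter_upwards [hW, disk_mem_nhds hF, eventually_norm_toFun_sub hF h ha, h1, hs]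
      with x h1 h2 h3 h4 h5 using ⟨h1, h2, h3, h4, h5⟩
  obtain ⟨ε, hε, hball⟩ := Metric.eventually_nhds_iff.1 hall
  obtain ⟨k, hk⟩ := exists_pow_lt_of_lt_one hε (inv_prime_lt_one (p := p))
  refine ⟨k, fun x hx => ?_⟩
  have hx' := hball (y := x) (by rw [dist_zero_right]; exact hx.trans_lt hk)
  refine ⟨hx'.1, hx'.2.1, hx'.2.2.1, hx'.2.2.2.1, fun y hy => ?_⟩
  exact hl x hx'.2.2.2.2 y (hball (y := y) (by rw [dist_zero_right]; exact hy.trans_lt hk)).2.2.2.2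

lemma norm_eq_inv_pow {x : ℚ_[p]} (hx0 : x ≠ 0) {k : ℕ} (hx : ‖x‖ ≤ (p : ℝ)⁻¹ ^ k) :
    ∃ j : ℕ, ‖x‖ = (p : ℝ)⁻¹ ^ (k + j) := by
  have hp1 : (1 : ℝ) < p := by exact_mod_cast (Fact.out : p.Prime).one_lt
  rw [Padic.norm_eq_zpow_neg_valuation hx0, inv_pow, ← zpow_natCast, ← zpow_neg] at *
  have := (zpow_le_zpow_iff_right₀ hp1).1 hx
  refine ⟨(x.valuation - k).toNat, ?_⟩
  rw [inv_pow, ← zpow_natCast, ← zpow_neg]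
  congr 1
  push_cast
  omega

/-- With `‖a‖ p^(-km) = p^(-E)`, the sphere of radius `p^(-(k+j))` splits into orbits that are balls
of radius `p^(-(k+j+E+jm))`, one for each unit modulo `p^(E+jm)`. These counts grow like `(p^m)^j`,
so the enumeration by blocks gives the bounds on `(n+1) * r n ^ m`. -/
theorem exists_orbitChart {F : PowerSeries ℚ_[p]} {m : ℕ} {a : ℚ_[p]} (hF : IsAnalytic F)
    (h : HasLeadingForm F m a) (hm : 1 ≤ m) (ha : a ≠ 0) {W : Set ℚ_[p]} (hW : W ∈ 𝓝 0) :
    ∃ χ : OrbitChart F m a, χ.U ⊆ W := by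
  have hp := (Fact.out : p.Prime)
  have hq := inv_prime_pos (p := p)
  have hq1 := inv_prime_lt_one (p := p)
  obtain ⟨k, hk⟩ := exists_good_ball hF h hm ha hW
  obtain ⟨E, hE0, hE⟩ : ∃ E : ℕ, E ≠ 0 ∧ ‖a‖ * ((p : ℝ)⁻¹ ^ k) ^ m = (p : ℝ)⁻¹ ^ E := by
    have hp0 : (p : ℚ_[p]) ≠ 0 := by exact_mod_cast hp.ne_zero
    have hlt := (hk ((p : ℚ_[p]) ^ k) (by rw [norm_pow, Padic.norm_p])).2.2.2.1
    have e : ‖a‖ * ‖(p : ℚ_[p]) ^ k‖ ^ m = ‖a * ((p : ℚ_[p]) ^ k) ^ m‖ := by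
      rw [norm_mul, norm_pow (_ ^ k)]
    rw [e] at hlt
    obtain ⟨E, hE⟩ := norm_eq_inv_pow (k := 0)
      (mul_ne_zero ha (pow_ne_zero m (pow_ne_zero k hp0))) (by simpa using hlt.le)
    rw [zero_add] at hE
    refine ⟨E, ?_, ?_⟩
    · rintro rfl
      rw [hE] at hlt
      simp at hlt
    · rw [← hE, ← e, norm_pow, Padic.norm_p]
  have hrad : ∀ j, ‖a‖ * ((p : ℝ)⁻¹ ^ (k + j)) ^ (m + 1) = (p : ℝ)⁻¹ ^ (k + j + (E + j * m)) := by
    intro j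
    have : ‖a‖ * ((p : ℝ)⁻¹ ^ (k + j)) ^ (m + 1)
        = (‖a‖ * ((p : ℝ)⁻¹ ^ k) ^ m) * ((p : ℝ)⁻¹ ^ (j * m) * (p : ℝ)⁻¹ ^ (k + j)) := by ring
    rw [this, hE, ← pow_add, ← pow_add]
    congr 1; ring
  have hle : ∀ j, (p : ℝ)⁻¹ ^ (k + j) ≤ (p : ℝ)⁻¹ ^ k := fun j =>
    pow_le_pow_of_le_one hq.le hq1.le (Nat.le_add_right k j)
  have hlt : ∀ j, ‖a‖ * ((p : ℝ)⁻¹ ^ (k + j)) ^ (m + 1) < (p : ℝ)⁻¹ ^ (k + j) := by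
    intro j
    rw [hrad]
    exact pow_lt_pow_right_of_lt_one₀ hq hq1 (by omega)
  have hNT : ∀ j, IsNearTranslation (toFun F) {x | ‖x‖ = (p : ℝ)⁻¹ ^ (k + j)}
      (‖a‖ * ((p : ℝ)⁻¹ ^ (k + j)) ^ (m + 1)) := by
    intro j
    have hb : ∀ x ∈ {x : ℚ_[p] | ‖x‖ = (p : ℝ)⁻¹ ^ (k + j)}, ‖x‖ ≤ (p : ℝ)⁻¹ ^ k :=
      fun x (hx : ‖x‖ = _) => hx.trans_le (hle j)
    have hn : ∀ x ∈ {x : ℚ_[p] | ‖x‖ = (p : ℝ)⁻¹ ^ (k + j)},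
        ‖toFun F x - x‖ = ‖a‖ * ((p : ℝ)⁻¹ ^ (k + j)) ^ (m + 1) := fun x hx => by
      rw [(hk x (hb x hx)).2.2.1, show ‖x‖ = _ from hx]
    refine ⟨fun x hx => ?_, hn, fun x hx y hy => (hk x (hb x hx)).2.2.2.2 y (hb y hy)⟩
    have hx' : ‖x‖ = (p : ℝ)⁻¹ ^ (k + j) := hx
    exact (norm_eq_of_norm_sub_lt (by rw [hn x hx, hx']; exact hlt j)).trans hx'
  have hball : ∀ j, ∀ x : ℚ_[p], ‖x‖ = (p : ℝ)⁻¹ ^ (k + j) →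
      Metric.closedBall x (‖a‖ * ((p : ℝ)⁻¹ ^ (k + j)) ^ (m + 1))
        ⊆ {x | ‖x‖ = (p : ℝ)⁻¹ ^ (k + j)} := by
    intro j x hx y hy
    rw [mem_closedBall_iff_norm] at hy
    exact (norm_eq_of_norm_sub_lt (hy.trans_lt (by rw [hx]; exact hlt j))).trans hx
  have hcpos : ∀ j, 0 < ‖a‖ * ((p : ℝ)⁻¹ ^ (k + j)) ^ (m + 1) := fun j => by
    rw [hrad]; positivity
  have : ∀ j, NeZero (p ^ (E + j * m)) := fun j => ⟨pow_ne_zero _ hp.ne_zero⟩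
  have hcard : ∀ j, Fintype.card (ZMod (p ^ (E + j * m)))ˣ
      = (p ^ (E - 1) * (p - 1)) * (p ^ m) ^ j := by
    intro j
    rw [ZMod.card_units_eq_totient, Nat.totient_prime_pow hp (by omega),
      show E + j * m - 1 = E - 1 + m * j by rw [mul_comm m j]; omega, pow_add, pow_mul]
    ring
  obtain ⟨e, he⟩ := exists_sigma_equiv_nat
    (mul_pos (pow_pos hp.pos _) (Nat.sub_pos_of_lt hp.one_lt))
    (hp.two_le.trans (Nat.le_self_pow (by omega) p)) hcard
  choose z hz hzu using fun j => exists_sphere_representatives (p := p) (k + j)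
    (E := E + j * m) (by omega)
  choose φ hφ0 hφsub hφmap hφrange using fun j r =>
    (hNT j).exists_flow (hcpos j) (hz j r) (hball j _ (hz j r))
  have hφmem : ∀ j r s, φ j r s ∈ Metric.closedBall (z j r)
      (‖a‖ * ((p : ℝ)⁻¹ ^ (k + j)) ^ (m + 1)) := fun j r s => hφrange j r ▸ mem_range_self s
  have hφnorm : ∀ j r s, ‖φ j r s‖ = (p : ℝ)⁻¹ ^ (k + j) := fun j r s =>
    hball j _ (hz j r) (hφmem j r s)
  -- The norm determines the sphere, and the unique nearby representative determines the ball.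
  have hφindex : ∀ x y : Σ j, (ZMod (p ^ (E + j * m)))ˣ, ∀ s t,
      φ x.1 x.2 s = φ y.1 y.2 t → x = y := by
    rintro ⟨j, i⟩ ⟨j', i'⟩ s t hst
    have h1 := hφnorm j i s
    rw [hst, hφnorm] at h1
    obtain rfl : j' = j :=
      Nat.add_left_cancel (pow_right_injective₀ hq hq1.ne h1)
    have h2 := mem_closedBall_iff_norm.1 (hφmem j' i s)
    have h3 := mem_closedBall_iff_norm.1 (hφmem j' i' t)
    rw [hrad] at h2 h3
    rw [← hst] at h3
    rw [(hzu j' _ (hφnorm j' i s)).unique h2 h3]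
  have hP : (0 : ℝ) < (p : ℝ) ^ m := by
    have : (0 : ℝ) < p := by exact_mod_cast hp.pos
    positivity
  have hcancel : ∀ j, ((p : ℝ)⁻¹ ^ (k + j)) ^ m = ((p : ℝ)⁻¹ ^ k) ^ m / ((p : ℝ) ^ m) ^ j := by
    intro j
    rw [eq_div_iff (by positivity)]
    have hp0 : (p : ℝ) ≠ 0 := by exact_mod_cast hp.ne_zero
    calc _ = ((p : ℝ)⁻¹ ^ k) ^ m * ((p : ℝ)⁻¹ * p) ^ (j * m) := by ring
      _ = _ := by rw [inv_mul_cancel₀ hp0, one_pow, mul_one]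
  refine ⟨{
    U := {x | ‖x‖ ≤ (p : ℝ)⁻¹ ^ k}
    Φ := fun n => φ (e.symm n).1 (e.symm n).2
    r := fun n => (p : ℝ)⁻¹ ^ (k + (e.symm n).1)
    isOpen_U := ?_
    U_subset := fun x hx => (hk x hx).2.1
    map_zero := toFun_zero h hm
    map_Φ := fun n s => hφmap _ _ s
    r_pos := fun n => by positivity
    r_le_one := fun n => pow_le_one₀ hq.le hq1.le
    norm_Φ := fun n s => hφnorm _ _ s
    norm_Φ_sub := fun n s t => hφsub _ _ s t
    index_eq := fun n l s t hst => e.symm.injective (hφindex _ _ s t hst)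
    mem_U_iff := fun x => ⟨fun hx => ?_, ?_⟩
    isOpen_range := fun n => ?_
    lower := ((p : ℝ)⁻¹ ^ k) ^ m / (p : ℝ) ^ m
    lower_pos := by positivity
    lower_le := fun n => ?_
    upper := 2 * ((p ^ (E - 1) * (p - 1) : ℕ) : ℝ) * ((p : ℝ)⁻¹ ^ k) ^ m
    le_upper := fun n => ?_ }, fun x hx => (hk x hx).1⟩
  · have := IsUltrametricDist.isOpen_closedBall (0 : ℚ_[p]) (pow_pos hq k).ne'
    convert this using 1
    ext x; simp
  · refine or_iff_not_imp_left.2 fun hx0 => ?_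
    obtain ⟨j, hj⟩ := norm_eq_inv_pow hx0 hx
    obtain ⟨i, hi, -⟩ := hzu j x hj
    have hxm : x ∈ range (φ j i) := by
      rw [hφrange, mem_closedBall_iff_norm, hrad]; exact hi
    obtain ⟨s, hs⟩ := hxm
    exact ⟨e ⟨j, i⟩, s, by rw [Equiv.symm_apply_apply]; exact hs⟩
  · rintro (rfl | ⟨n, s, rfl⟩)
    · exact norm_zero.trans_le (pow_pos hq k).le
    · exact (hφnorm _ _ s).trans_le (hle _)
  · rw [hφrange]
    exact IsUltrametricDist.isOpen_closedBall _ (hcpos _).ne'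
  · have h1 := (he (e.symm n)).1
    rw [Equiv.apply_symm_apply] at h1
    have h2 : ((p : ℝ) ^ m) ^ (e.symm n).1 ≤ (p : ℝ) ^ m * (n + 1) := by exact_mod_cast h1
    rw [hcancel, div_le_iff₀ hP, mul_div_assoc', div_mul_eq_mul_div, le_div_iff₀ (by positivity)]
    have : (0 : ℝ) ≤ ((p : ℝ)⁻¹ ^ k) ^ m := by positivity
    nlinarith [mul_le_mul_of_nonneg_left h2 this]
  · have h1 := (he (e.symm n)).2
    rw [Equiv.apply_symm_apply] at h1
    have h2 : (n : ℝ) + 1 ≤ 2 * ((p ^ (E - 1) * (p - 1) : ℕ) : ℝ) * ((p : ℝ) ^ m) ^ (e.symm n).1 := by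
      exact_mod_cast h1
    rw [hcancel, mul_div_assoc', div_le_iff₀ (by positivity)]
    have : (0 : ℝ) ≤ ((p : ℝ)⁻¹ ^ k) ^ m := by positivity
    nlinarith [mul_le_mul_of_nonneg_right h2 this]

/-! ### The conjugacy matching orbits by index -/

namespace OrbitChart

variable {F G : PowerSeries ℚ_[p]} {m m' : ℕ} {a a' : ℚ_[p]}

lemma Φ_ne_zero (χ : OrbitChart F m a) (n : ℕ) (s : ℤ_[p]) : χ.Φ n s ≠ 0 :=
  norm_pos_iff.1 ((χ.norm_Φ n s).symm ▸ χ.r_pos n)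

lemma zero_mem (χ : OrbitChart F m a) : (0 : ℚ_[p]) ∈ χ.U := (χ.mem_U_iff 0).2 (Or.inl rfl)

lemma Φ_mem (χ : OrbitChart F m a) (n : ℕ) (s : ℤ_[p]) : χ.Φ n s ∈ χ.U :=
  (χ.mem_U_iff _).2 (Or.inr ⟨n, s, rfl⟩)

lemma radius_pos (χ : OrbitChart F m a) (ha : a ≠ 0) (n : ℕ) : 0 < ‖a‖ * χ.r n ^ (m + 1) :=
  mul_pos (norm_pos_iff.2 ha) (pow_pos (χ.r_pos n) _)

lemma Φ_inj (χ : OrbitChart F m a) (ha : a ≠ 0) {n k : ℕ} {s t : ℤ_[p]}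
    (h : χ.Φ n s = χ.Φ k t) : n = k ∧ s = t := by
  obtain rfl := χ.index_eq _ _ _ _ h
  have := χ.norm_Φ_sub n s t
  rw [h, sub_self, norm_zero, eq_comm, mul_eq_zero, or_iff_right (χ.radius_pos ha n).ne',
    norm_eq_zero, sub_eq_zero] at this
  exact ⟨rfl, this⟩

lemma continuous_Φ (χ : OrbitChart F m a) (n : ℕ) : Continuous (χ.Φ n) := by
  have h0 : 0 ≤ ‖a‖ * χ.r n ^ (m + 1) := mul_nonneg (norm_nonneg _) (pow_nonneg (χ.r_pos n).le _)
  refine (LipschitzWith.of_dist_le_mul (K := ⟨_, h0⟩) fun s t => ?_).continuous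
  rw [dist_eq_norm, dist_eq_norm, χ.norm_Φ_sub]; rfl

lemma bijOn (χ : OrbitChart F m a) (ha : a ≠ 0) : BijOn (toFun F) χ.U χ.U := by
  refine ⟨fun x hx => ?_, fun x hx y hy hxy => ?_, fun x hx => ?_⟩
  · obtain rfl | ⟨n, s, rfl⟩ := (χ.mem_U_iff x).1 hx
    · rw [χ.map_zero]; exact χ.zero_mem
    · rw [χ.map_Φ]; exact χ.Φ_mem _ _
  · obtain rfl | ⟨n, s, rfl⟩ := (χ.mem_U_iff x).1 hx <;>
      obtain rfl | ⟨k, t, rfl⟩ := (χ.mem_U_iff y).1 hy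
    · rfl
    · rw [χ.map_zero, χ.map_Φ] at hxy
      exact absurd hxy.symm (χ.Φ_ne_zero _ _)
    · rw [χ.map_zero, χ.map_Φ] at hxy
      exact absurd hxy (χ.Φ_ne_zero _ _)
    · rw [χ.map_Φ, χ.map_Φ] at hxy
      obtain ⟨rfl, hst⟩ := χ.Φ_inj ha hxy
      rw [add_right_cancel hst]
  · obtain rfl | ⟨n, s, rfl⟩ := (χ.mem_U_iff x).1 hx
    · exact ⟨0, χ.zero_mem, χ.map_zero⟩
    · exact ⟨χ.Φ n (s - 1), χ.Φ_mem _ _, by rw [χ.map_Φ, sub_add_cancel]⟩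

/-- The range of `Φ n` is compact and forward invariant, so it contains the closure of the iterates
of each of its points. -/
lemma of_sameZpOrbit (χ : OrbitChart F m a) {x y : ℚ_[p]} (h : SameZpOrbit (toFun F) χ.U x y) :
    (x = 0 ∧ y = 0) ∨ ∃ n s t, χ.Φ n s = x ∧ χ.Φ n t = y := by
  obtain ⟨w, hw, hx, hy⟩ := h
  obtain rfl | ⟨n, s, rfl⟩ := (χ.mem_U_iff w).1 hw
  · have : zpOrbit (toFun F) 0 ⊆ {0} := by
      refine closure_minimal (range_subset_iff.2 fun n => ?_) isClosed_singleton
      exact Function.iterate_fixed χ.map_zero n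
    exact Or.inl ⟨this hx, this hy⟩
  · have : zpOrbit (toFun F) (χ.Φ n s) ⊆ range (χ.Φ n) := by
      refine closure_minimal (range_subset_iff.2 fun k => ?_)
        (isCompact_range (χ.continuous_Φ n)).isClosed
      induction k with
      | zero => exact mem_range_self s
      | succ k ih =>
        obtain ⟨t, ht⟩ := ih
        rw [Function.iterate_succ_apply', ← ht, χ.map_Φ]
        exact mem_range_self _
    obtain ⟨s', hs⟩ := this hx
    obtain ⟨t', ht⟩ := this hy
    exact Or.inr ⟨n, s', t', hs, ht⟩

lemma upper_pos (χ : OrbitChart F m a) : 0 < χ.upper :=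
  χ.lower_pos.trans_le ((χ.lower_le 0).trans (χ.le_upper 0))

/-- The orbits with the same index in two charts have comparable sizes. -/
lemma exists_r_le (χ : OrbitChart F m a) (ψ : OrbitChart G m' a') (hm' : 1 ≤ m') :
    ∃ K : ℝ, 0 < K ∧ ∀ n, ψ.r n ≤ K * χ.r n ^ ((m : ℝ) / m') := by
  have hm0 : (m' : ℝ) ≠ 0 := by positivity
  have hq : 0 < ψ.upper / χ.lower := div_pos ψ.upper_pos χ.lower_pos
  refine ⟨(ψ.upper / χ.lower) ^ ((m' : ℝ)⁻¹), Real.rpow_pos_of_pos hq _, fun n => ?_⟩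
  have hr := χ.r_pos n
  have hr' := ψ.r_pos n
  -- Eliminate `n + 1` between the two counting bounds.
  have h1 : ψ.r n ^ m' ≤ ψ.upper / χ.lower * χ.r n ^ m := by
    have h2 := χ.lower_le n
    have h3 := ψ.le_upper n
    have hn : (0 : ℝ) < n + 1 := by positivity
    rw [div_mul_eq_mul_div, le_div_iff₀ χ.lower_pos]
    calc ψ.r n ^ m' * χ.lower ≤ ψ.r n ^ m' * ((n + 1) * χ.r n ^ m) := by gcongr
      _ = ((n + 1) * ψ.r n ^ m') * χ.r n ^ m := by ring
      _ ≤ _ := by gcongr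
  have h2 := Real.rpow_le_rpow (by positivity) h1 (inv_nonneg.2 (Nat.cast_nonneg m'))
  rwa [Real.pow_rpow_inv_natCast hr'.le (by omega), Real.mul_rpow hq.le (by positivity),
    ← Real.rpow_natCast, ← Real.rpow_mul hr.le, ← div_eq_mul_inv] at h2

/-- Both distances are multiples of `‖s - t‖ ≤ 1`, so `β ≤ 1` handles that factor. The other
hypothesis compares exponents of `χ.r n ≤ 1` after `ψ.r n` is bounded by a power of it. -/
lemma exists_holder_on_orbits (χ : OrbitChart F m a) (ψ : OrbitChart G m' a') (hm' : 1 ≤ m')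
    (ha : a ≠ 0) {β : ℝ} (hβ1 : β ≤ 1)
    (hβ : β * (m + 1) ≤ (m : ℝ) / m' * (m' + 1)) :
    ∃ C : ℝ, ∀ n s t, ‖ψ.Φ n s - ψ.Φ n t‖ ≤ C * ‖χ.Φ n s - χ.Φ n t‖ ^ β := by
  obtain ⟨K, hK, hr⟩ := χ.exists_r_le ψ hm'
  have ha0 := norm_pos_iff.2 ha
  refine ⟨‖a'‖ * K ^ (m' + 1) / ‖a‖ ^ β, fun n s t => ?_⟩
  have hr0 := χ.r_pos n
  have hr0' := ψ.r_pos n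
  have hd : ‖s - t‖ ≤ ‖s - t‖ ^ β := by
    rcases (norm_nonneg (s - t)).eq_or_lt with h | h
    · rw [← h]; exact Real.rpow_nonneg le_rfl _
    · simpa using Real.rpow_le_rpow_of_exponent_ge h (PadicInt.norm_le_one _) hβ1
  have h1 : ψ.r n ^ (m' + 1) ≤ K ^ (m' + 1) * (χ.r n ^ (m + 1)) ^ β := by
    calc ψ.r n ^ (m' + 1) ≤ (K * χ.r n ^ ((m : ℝ) / m')) ^ (m' + 1) := by gcongr; exact hr n
      _ = K ^ (m' + 1) * χ.r n ^ ((m : ℝ) / m' * (m' + 1)) := by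
        rw [mul_pow, ← Real.rpow_natCast (χ.r n ^ _), ← Real.rpow_mul hr0.le]; push_cast; rfl
      _ ≤ K ^ (m' + 1) * χ.r n ^ (β * (m + 1)) := by
        gcongr ?_ * ?_
        exact Real.rpow_le_rpow_of_exponent_ge hr0 (χ.r_le_one n) hβ
      _ = _ := by
        rw [← Real.rpow_natCast (χ.r n), ← Real.rpow_mul hr0.le, mul_comm β]; push_cast; rfl
  rw [χ.norm_Φ_sub, ψ.norm_Φ_sub, Real.mul_rpow (by positivity) (norm_nonneg _),
    Real.mul_rpow ha0.le (by positivity)]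
  have ha1 : 0 < ‖a‖ ^ β := Real.rpow_pos_of_pos ha0 _
  calc ‖a'‖ * ψ.r n ^ (m' + 1) * ‖s - t‖
      ≤ ‖a'‖ * (K ^ (m' + 1) * (χ.r n ^ (m + 1)) ^ β) * ‖s - t‖ ^ β := by gcongr
    _ = _ := by field_simp

open Classical in
/-- The map sending each orbit in the chart `χ` to the orbit with the same index in `ψ`. -/
noncomputable def transfer (χ : OrbitChart F m a) (ψ : OrbitChart G m' a') (x : ℚ_[p]) : ℚ_[p] :=
  -- The default value matters: it is the value at the fixed point `0`.
  if h : ∃ q : ℕ × ℤ_[p], χ.Φ q.1 q.2 = x then ψ.Φ h.choose.1 h.choose.2 else 0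

lemma transfer_zero (χ : OrbitChart F m a) (ψ : OrbitChart G m' a') : χ.transfer ψ 0 = 0 :=
  dif_neg fun ⟨_, hq⟩ => χ.Φ_ne_zero _ _ hq

lemma transfer_Φ (χ : OrbitChart F m a) (ψ : OrbitChart G m' a') (ha : a ≠ 0) (n : ℕ)
    (s : ℤ_[p]) : χ.transfer ψ (χ.Φ n s) = ψ.Φ n s := by
  have h : ∃ q : ℕ × ℤ_[p], χ.Φ q.1 q.2 = χ.Φ n s := ⟨(n, s), rfl⟩
  obtain ⟨h1, h2⟩ := χ.Φ_inj ha h.choose_spec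
  rw [transfer, dif_pos h, h1, h2]

lemma exists_norm_transfer_le (χ : OrbitChart F m a) (ψ : OrbitChart G m' a') (ha : a ≠ 0)
    (hm : 1 ≤ m) (hm' : 1 ≤ m') :
    ∃ K : ℝ, 0 < K ∧ ∀ x ∈ χ.U, ‖χ.transfer ψ x‖ ≤ K * ‖x‖ ^ ((m : ℝ) / m') := by
  obtain ⟨K, hK, hr⟩ := χ.exists_r_le ψ hm'
  refine ⟨K, hK, fun x hx => ?_⟩
  obtain rfl | ⟨n, s, rfl⟩ := (χ.mem_U_iff x).1 hx
  · rw [transfer_zero, norm_zero, Real.zero_rpow (by positivity), mul_zero]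
  · rw [χ.transfer_Φ ψ ha, ψ.norm_Φ, χ.norm_Φ]; exact hr n

lemma transfer_mem (χ : OrbitChart F m a) (ψ : OrbitChart G m' a') (ha : a ≠ 0) {x : ℚ_[p]}
    (hx : x ∈ χ.U) : χ.transfer ψ x ∈ ψ.U := by
  obtain rfl | ⟨n, s, rfl⟩ := (χ.mem_U_iff x).1 hx
  · rw [transfer_zero]; exact ψ.zero_mem
  · rw [χ.transfer_Φ ψ ha]; exact ψ.Φ_mem _ _

lemma transfer_transfer (χ : OrbitChart F m a) (ψ : OrbitChart G m' a') (ha : a ≠ 0)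
    (ha' : a' ≠ 0) {x : ℚ_[p]} (hx : x ∈ χ.U) : ψ.transfer χ (χ.transfer ψ x) = x := by
  obtain rfl | ⟨n, s, rfl⟩ := (χ.mem_U_iff x).1 hx
  · rw [transfer_zero, transfer_zero]
  · rw [χ.transfer_Φ ψ ha, ψ.transfer_Φ χ ha']

/-- Away from `0` the orbits are open and the map is a similarity on each; at `0` the power bound
suffices. -/
lemma continuousOn_transfer (χ : OrbitChart F m a) (ψ : OrbitChart G m' a') (ha : a ≠ 0)
    (hm : 1 ≤ m) (hm' : 1 ≤ m') : ContinuousOn (χ.transfer ψ) χ.U := by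
  intro x hx
  refine ContinuousAt.continuousWithinAt ?_
  rw [ContinuousAt, tendsto_iff_norm_sub_tendsto_zero]
  obtain rfl | ⟨n, s, rfl⟩ := (χ.mem_U_iff x).1 hx
  · obtain ⟨K, -, hK⟩ := χ.exists_norm_transfer_le ψ ha hm hm'
    have hpos : 0 < (m : ℝ) / m' := by positivity
    have hlim : Tendsto (fun x : ℚ_[p] => K * ‖x‖ ^ ((m : ℝ) / m')) (𝓝 0) (𝓝 0) := by
      have : ContinuousAt (fun x : ℚ_[p] => K * ‖x‖ ^ ((m : ℝ) / m')) 0 :=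
        continuousAt_const.mul (continuous_norm.continuousAt.rpow_const (Or.inr hpos.le))
      simpa [ContinuousAt, Real.zero_rpow hpos.ne'] using this
    refine squeeze_zero' (Eventually.of_forall fun _ => norm_nonneg _) ?_ hlim
    filter_upwards [χ.isOpen_U.mem_nhds χ.zero_mem] with y hy
    rw [transfer_zero, sub_zero]
    exact hK y hy
  · have hpos := χ.radius_pos ha n
    set c := ‖a‖ * χ.r n ^ (m + 1)
    set c' := ‖a'‖ * ψ.r n ^ (m' + 1)
    have hlim : Tendsto (fun y => c' / c * ‖y - χ.Φ n s‖) (𝓝 (χ.Φ n s)) (𝓝 0) := by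
      have : ContinuousAt (fun y => c' / c * ‖y - χ.Φ n s‖) (χ.Φ n s) := by fun_prop
      simpa [ContinuousAt] using this
    refine squeeze_zero' (Eventually.of_forall fun _ => norm_nonneg _) ?_ hlim
    filter_upwards [(χ.isOpen_range n).mem_nhds (mem_range_self s)] with y ⟨t, ht⟩
    rw [← ht, χ.transfer_Φ ψ ha, χ.transfer_Φ ψ ha, χ.norm_Φ_sub, ψ.norm_Φ_sub, ← mul_assoc,
      div_mul_cancel₀ _ hpos.ne']

/-- The homeomorphism matching the orbits of two charts by their indices. -/
noncomputable def homeomorph (χ : OrbitChart F m a) (ψ : OrbitChart G m' a') (ha : a ≠ 0)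
    (ha' : a' ≠ 0) (hm : 1 ≤ m) (hm' : 1 ≤ m') : OpenPartialHomeomorph ℚ_[p] ℚ_[p] where
  toFun := χ.transfer ψ
  invFun := ψ.transfer χ
  source := χ.U
  target := ψ.U
  map_source' _ := χ.transfer_mem ψ ha
  map_target' _ := ψ.transfer_mem χ ha'
  left_inv' _ := χ.transfer_transfer ψ ha ha'
  right_inv' _ := ψ.transfer_transfer χ ha' ha
  open_source := χ.isOpen_U
  open_target := ψ.isOpen_U
  continuousOn_toFun := χ.continuousOn_transfer ψ ha hm hm'
  continuousOn_invFun := ψ.continuousOn_transfer χ ha' hm' hm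

lemma conjugates_homeomorph (χ : OrbitChart F m a) (ψ : OrbitChart G m' a') (ha : a ≠ 0)
    (ha' : a' ≠ 0) (hm : 1 ≤ m) (hm' : 1 ≤ m') :
    Conjugates (χ.homeomorph ψ ha ha' hm hm') F G where
  zero_mem := χ.zero_mem
  map_zero := χ.transfer_zero ψ
  source_subset := χ.U_subset
  target_subset := ψ.U_subset
  bijOn_source := χ.bijOn ha
  bijOn_target := ψ.bijOn ha'
  comm x hx := by
    change χ.transfer ψ (toFun F x) = toFun G (χ.transfer ψ x)
    obtain rfl | ⟨n, s, rfl⟩ := (χ.mem_U_iff x).1 hx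
    · rw [χ.map_zero, transfer_zero, ψ.map_zero]
    · rw [χ.map_Φ, χ.transfer_Φ ψ ha, χ.transfer_Φ ψ ha, ψ.map_Φ]

lemma exists_transfer_holder (χ : OrbitChart F m a) (ψ : OrbitChart G m' a') (hm' : 1 ≤ m')
    (ha : a ≠ 0) {β : ℝ} (hβ0 : 0 < β) (hβ1 : β ≤ 1)
    (hβ : β * (m + 1) ≤ (m : ℝ) / m' * (m' + 1)) :
    ∃ C : ℝ, ∀ x y, SameZpOrbit (toFun F) χ.U x y →
      ‖χ.transfer ψ y - χ.transfer ψ x‖ ≤ C * ‖y - x‖ ^ β := by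
  obtain ⟨C, hC⟩ := χ.exists_holder_on_orbits ψ hm' ha hβ1 hβ
  refine ⟨C, fun x y hxy => ?_⟩
  obtain ⟨rfl, rfl⟩ | ⟨n, s, t, rfl, rfl⟩ := χ.of_sameZpOrbit hxy
  · rw [sub_self, sub_self, norm_zero, Real.zero_rpow hβ0.ne', mul_zero]
  · rw [χ.transfer_Φ ψ ha, χ.transfer_Φ ψ ha]
    exact hC n t s

end OrbitChart

/-! ### Optimality of the exponent -/

variable {F G : PowerSeries ℚ_[p]} {m m' : ℕ} {a a' : ℚ_[p]}

/-- A conjugacy that is defined on the whole of a chart carries orbits to orbits. -/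
lemma OrbitChart.exists_index_map (χ : OrbitChart F m a) (ψ : OrbitChart G m' a')
    {h : OpenPartialHomeomorph ℚ_[p] ℚ_[p]} (hsrc : χ.U ⊆ h.source) (h0 : h 0 = 0)
    (hmaps : ∀ x ∈ χ.U, h x ∈ ψ.U) (hcomm : ∀ x ∈ χ.U, h (toFun F x) = toFun G (h x)) :
    ∃ (σ : ℕ → ℕ) (u : ℕ → ℤ_[p]), ∀ n s, h (χ.Φ n s) = ψ.Φ (σ n) (u n + s) := by
  have hex : ∀ n, ∃ k t, ψ.Φ k t = h (χ.Φ n 0) := by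
    intro n
    refine ((ψ.mem_U_iff _).1 (hmaps _ (χ.Φ_mem n 0))).resolve_left fun hz => ?_
    rw [← h0] at hz
    exact χ.Φ_ne_zero n 0 (h.injOn (hsrc (χ.Φ_mem n 0)) (hsrc χ.zero_mem) hz)
  choose σ u hu using hex
  refine ⟨σ, u, fun n => congr_fun ?_⟩
  -- Both sides are continuous in `s`, and the conjugacy relation gives equality at natural numbers.
  refine PadicInt.denseRange_natCast.equalizer
    (h.continuousOn.comp_continuous (χ.continuous_Φ n) fun s => hsrc (χ.Φ_mem n s))
    ((ψ.continuous_Φ _).comp (continuous_const_add _)) (funext fun k => ?_)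
  simp only [Function.comp_apply]
  induction k with
  | zero => simpa using (hu n).symm
  | succ k ih =>
    push_cast
    rw [← χ.map_Φ, hcomm _ (χ.Φ_mem _ _), ih, ψ.map_Φ, add_assoc]

lemma OrbitChart.tendsto_r (χ : OrbitChart F m a) (hm : 1 ≤ m) : Tendsto χ.r atTop (𝓝 0) := by
  have h1 : Tendsto (fun n => χ.r n ^ m) atTop (𝓝 0) := by
    refine squeeze_zero (fun n => pow_nonneg (χ.r_pos n).le m) (fun n => ?_)
      (tendsto_const_div_atTop_nhds_zero_nat χ.upper |>.comp (tendsto_add_atTop_nat 1))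
    rw [Function.comp_apply, le_div_iff₀ (by positivity), mul_comm]
    exact_mod_cast χ.le_upper n
  have h2 := h1.rpow_const (p := (m : ℝ)⁻¹) (Or.inr (by positivity))
  rw [Real.zero_rpow (by positivity)] at h2
  exact h2.congr fun n => Real.pow_rpow_inv_natCast (χ.r_pos n).le (by omega)

/-- A section of a map `ℕ → ℕ` defined from `N` on takes values at least `M` among any
`M + 1` consecutive arguments. -/
lemma exists_large_preimage {σ : ℕ → ℕ} {N : ℕ} (hσ : ∀ n ≥ N, ∃ k, σ k = n) (M : ℕ) :
    ∃ k, M ≤ k ∧ σ k ≤ N + M := by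
  by_contra! hcon
  -- Pigeonhole: otherwise `M + 1` values would all come from the `M` arguments below `M`.
  have hsub : Finset.Icc N (N + M) ⊆ (Finset.range M).image σ := by
    intro n hn
    rw [Finset.mem_Icc] at hn
    obtain ⟨k, rfl⟩ := hσ n hn.1
    refine Finset.mem_image_of_mem σ (Finset.mem_range.2 (not_le.1 fun hk => ?_))
    exact absurd (hcon k hk) (not_lt.2 hn.2)
  have := (Finset.card_le_card hsub).trans Finset.card_image_le
  rw [Nat.card_Icc, Finset.card_range] at this
  omega

theorem not_exists_germConjugates (hm : 1 ≤ m) (hm' : 1 ≤ m') (ha : a ≠ 0) (ha' : a' ≠ 0)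
    (hF : IsAnalytic F) (hG : IsAnalytic G) (hFa : HasLeadingForm F m a)
    (hGa : HasLeadingForm G m' a') {α : ℝ} (hα : (m : ℝ) / m' < α) :
    ¬ ∃ (h : OpenPartialHomeomorph ℚ_[p] ℚ_[p]) (C : ℝ), GermConjugates h F G ∧
      ∀ᶠ x in 𝓝 (0 : ℚ_[p]), ‖h x‖ ≤ C * ‖x‖ ^ α := by
  rintro ⟨h, C, hh, hC⟩
  obtain ⟨ψ, -⟩ := exists_orbitChart hG hGa hm' ha' univ_mem
  have hcont : ContinuousAt h 0 := h.continuousAt hh.zero_mem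
  have hU : ∀ᶠ x in 𝓝 (0 : ℚ_[p]), h x ∈ ψ.U := by
    refine hcont.eventually_mem ?_
    rw [hh.map_zero]
    exact ψ.isOpen_U.mem_nhds ψ.zero_mem
  -- The chart is taken so small that every germ condition holds on all of it.
  obtain ⟨χ, hχ⟩ := exists_orbitChart hF hFa hm ha
    (((h.open_source.eventually_mem hh.zero_mem).and hh.comm).and (hU.and hC))
  obtain ⟨σ, u, hσ⟩ := χ.exists_index_map ψ (fun x hx => (hχ hx).1.1) hh.map_zero
    (fun x hx => (hχ hx).2.1) (fun x hx => (hχ hx).1.2)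
  have himg : h '' χ.U ∈ 𝓝 0 :=
    (h.isOpen_image_of_subset_source χ.isOpen_U fun x hx => (hχ hx).1.1).mem_nhds
      ⟨0, χ.zero_mem, hh.map_zero⟩
  obtain ⟨δ, hδ, hball⟩ := Metric.mem_nhds_iff.1 himg
  obtain ⟨N, hN⟩ := eventually_atTop.1 ((ψ.tendsto_r hm').eventually_lt_const hδ)
  have hsurj : ∀ n ≥ N, ∃ k, σ k = n := by
    intro n hn
    obtain ⟨x, hx, hxe⟩ := hball (show ψ.Φ n 0 ∈ Metric.ball 0 δ by
      rw [mem_ball_zero_iff, ψ.norm_Φ]; exact hN n hn)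
    obtain rfl | ⟨k, t, rfl⟩ := (χ.mem_U_iff x).1 hx
    · exact absurd (hxe.symm.trans hh.map_zero) (ψ.Φ_ne_zero n 0)
    · rw [hσ] at hxe
      exact ⟨k, ψ.index_eq _ _ _ _ hxe⟩
  have hr : ∀ k, ψ.r (σ k) ≤ |C| * χ.r k ^ α := by
    intro k
    have := (hχ (χ.Φ_mem k 0)).2.2
    rw [hσ, ψ.norm_Φ, χ.norm_Φ] at this
    exact this.trans (mul_le_mul_of_nonneg_right (le_abs_self C)
      (Real.rpow_nonneg (χ.r_pos k).le _))
  have hm0 : (0 : ℝ) < m := by exact_mod_cast hm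
  have hm0' : (0 : ℝ) < m' := by exact_mod_cast hm'
  -- Chosen so that `(r^α)^m' = (r^m)^β`; the hypothesis on `α` becomes `β > 1`.
  set β : ℝ := α * m' / m with hβ
  have hβ1 : 1 < β := by
    rw [hβ, lt_div_iff₀ hm0, one_mul]
    exact (div_lt_iff₀ hm0').1 hα
  have hβ0 : 0 ≤ β := by linarith
  set D := 2 * |C| ^ m' * χ.upper ^ β
  -- An orbit of index at least `M` goes to one of index at most `N + M ≤ 2M`. Comparing sizes
  -- bounds the positive constant `ψ.lower` by a quantity tending to `0`.
  have key : ∀ M : ℕ, N ≤ M → ψ.lower ≤ D * ((M : ℝ) + 1) ^ (-(β - 1)) := by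
    intro M hM
    obtain ⟨k, hk, hσk⟩ := exists_large_preimage hsurj M
    have hM0 : (0 : ℝ) < M + 1 := by positivity
    have hr0 := χ.r_pos k
    have hr1 := ψ.r_pos (σ k)
    have h1 : χ.r k ^ m ≤ χ.upper / (M + 1) := by
      rw [le_div_iff₀ hM0, mul_comm]
      refine le_trans ?_ (χ.le_upper k)
      have : (M : ℝ) ≤ k := by exact_mod_cast hk
      gcongr
    have h2 : (χ.r k ^ α) ^ m' ≤ χ.upper ^ β / (M + 1) ^ β := by
      have e : (χ.r k ^ α) ^ m' = (χ.r k ^ m) ^ β := by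
        rw [← Real.rpow_natCast, ← Real.rpow_natCast, ← Real.rpow_mul hr0.le,
          ← Real.rpow_mul hr0.le, hβ, mul_div_cancel₀ _ hm0.ne']
      rw [e, ← Real.div_rpow χ.upper_pos.le hM0.le]
      exact Real.rpow_le_rpow (by positivity) h1 hβ0
    have h3 : ((σ k : ℝ) + 1) ≤ 2 * (M + 1) := by
      have : σ k + 1 ≤ 2 * (M + 1) := by omega
      exact_mod_cast this
    calc ψ.lower ≤ (σ k + 1) * ψ.r (σ k) ^ m' := ψ.lower_le _
      _ ≤ (2 * (M + 1)) * (|C| * χ.r k ^ α) ^ m' := by gcongr; exact hr k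
      _ = (2 * (M + 1)) * (|C| ^ m' * (χ.r k ^ α) ^ m') := by rw [mul_pow]
      _ ≤ (2 * (M + 1)) * (|C| ^ m' * (χ.upper ^ β / (M + 1) ^ β)) := by gcongr
      _ = D * ((M : ℝ) + 1) ^ (-(β - 1)) := by
        rw [neg_sub, Real.rpow_sub hM0, Real.rpow_one]
        ring
  have hlim : Tendsto (fun M : ℕ => D * ((M : ℝ) + 1) ^ (-(β - 1))) atTop (𝓝 (D * 0)) := by
    refine Tendsto.const_mul D ((tendsto_rpow_neg_atTop (by linarith)).comp ?_)
    exact tendsto_atTop_add_const_right _ _ tendsto_natCast_atTop_atTop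
  rw [mul_zero] at hlim
  exact absurd (ge_of_tendsto hlim (eventually_atTop.2 ⟨N, key⟩)) (not_le.2 ψ.lower_pos)

end PadicConj

theorem theorem1p2 (p : ℕ) [Fact p.Prime] (m m' : ℕ) (hm : 1 ≤ m) (hm' : 1 ≤ m')
    (a a' : ℚ_[p]) (ha : a ≠ 0) (ha' : a' ≠ 0) (f g : PowerSeries ℚ_[p])
    (hf : PadicConj.IsAnalytic f) (hg : PadicConj.IsAnalytic g)
    (hfa : PadicConj.HasLeadingForm f m a) (hga : PadicConj.HasLeadingForm g m' a') :
    (∃ h : OpenPartialHomeomorph ℚ_[p] ℚ_[p], PadicConj.Conjugates h f g) ∧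
    (m ≤ m' →
      (∃ (h : OpenPartialHomeomorph ℚ_[p] ℚ_[p]) (C : ℝ), 0 < C ∧ PadicConj.Conjugates h f g ∧
        (∀ x ∈ h.source, ‖h x‖ ≤ C * ‖x‖ ^ ((m : ℝ) / (m' : ℝ))) ∧
        (∀ x ∈ h.source, ∀ y ∈ h.source,
          PadicConj.SameZpOrbit (PadicConj.toFun f) h.source x y →
            ‖h y - h x‖ ≤ C * ‖y - x‖ ^ ((m : ℝ) / (m' : ℝ))) ∧
        (∀ x ∈ h.target, ∀ y ∈ h.target,
          PadicConj.SameZpOrbit (PadicConj.toFun g) h.target x y →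
            ‖h.symm y - h.symm x‖ ≤ C * ‖y - x‖ ^ ((m : ℝ) / (m' : ℝ)))) ∧
      (∀ α : ℝ, (m : ℝ) / (m' : ℝ) < α →
        ¬ ∃ (h : OpenPartialHomeomorph ℚ_[p] ℚ_[p]) (C : ℝ), PadicConj.GermConjugates h f g ∧
          ∀ᶠ x in 𝓝 (0 : ℚ_[p]), ‖h x‖ ≤ C * ‖x‖ ^ α)) := by
  obtain ⟨χ, -⟩ := PadicConj.exists_orbitChart hf hfa hm ha univ_mem
  obtain ⟨ψ, -⟩ := PadicConj.exists_orbitChart hg hga hm' ha' univ_mem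
  have hconj := χ.conjugates_homeomorph ψ ha ha' hm hm'
  refine ⟨⟨_, hconj⟩, fun hmm => ⟨?_, fun α hα =>
    PadicConj.not_exists_germConjugates hm hm' ha ha' hf hg hfa hga hα⟩⟩
  have hm0 : (0 : ℝ) < m := by exact_mod_cast hm
  have hm0' : (0 : ℝ) < m' := by exact_mod_cast hm'
  have hmm' : (m : ℝ) ≤ m' := by exact_mod_cast hmm
  have hβ0 : 0 < (m : ℝ) / m' := div_pos hm0 hm0'
  have hβ1 : (m : ℝ) / m' ≤ 1 := (div_le_one hm0').2 hmm'
  have hβ2 : (1 : ℝ) ≤ m' / m := (one_le_div hm0).2 hmm'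
  obtain ⟨C₁, hC₁, h₁⟩ := χ.exists_norm_transfer_le ψ ha hm hm'
  obtain ⟨C₂, h₂⟩ := χ.exists_transfer_holder ψ hm' ha hβ0 hβ1
    (mul_le_mul_of_nonneg_left (by linarith) hβ0.le)
  -- For the inverse the exponent condition reads `m + m/m' ≤ m' + m'/m`, which follows from `m ≤
  -- m'`.
  obtain ⟨C₃, h₃⟩ := ψ.exists_transfer_holder χ hm ha' hβ0 hβ1 (by
    have e1 : (m : ℝ) / m' * m' = m := div_mul_cancel₀ _ hm0'.ne'
    have e2 : (m' : ℝ) / m * m = m' := div_mul_cancel₀ _ hm0.ne'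
    rw [mul_add, mul_add, e1, e2]
    linarith)
  refine ⟨_, max C₁ (max C₂ C₃), hC₁.trans_le (le_max_left _ _), hconj, fun x hx => ?_,
    fun x _ y _ hxy => ?_, fun x _ y _ hxy => ?_⟩
  · refine (h₁ x hx).trans ?_
    gcongr
    exact le_max_left _ _
  · refine (h₂ x y hxy).trans ?_
    gcongr
    exact (le_max_left _ _).trans (le_max_right _ _)
  · refine (h₃ x y hxy).trans ?_
    gcongr
    exact (le_max_right _ _).trans (le_max_right _ _)
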